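/- Let $(M,g)$ be a compact connected Hermitian manifold and $(N,h)$ a Hermitian manifold, of arbitrary complex dimensions $m$ and $n$: that is, Hausdorff complex manifolds with a smooth positive definite Hermitian form on the holomorphic tangent bundle. In a local holomorphic chart $(z^1,\dots,z^m)$ with $g_{i\bar j}=g(\partial/\partial z^i,\partial/\partial z^j)$, the curvature tensor of the Chern connection of $g$ is $$R_{i\bar jk\bar l}=-\frac{\partial^2 g_{k\bar l}}{\partial z^i\partial\bar z^j}+\sum_{p,q} g^{p\bar q}\,\frac{\partial g_{k\bar q}}{\partial z^i}\,\frac{\partial g_{p\bar l}}{\partial\bar z^j},\qquad \sum_q g^{p\bar q}g_{k\bar q}=\delta_{pk},$$ and the holomorphic sectional curvature in the direction of a nonzero holomorphic tangent vector $v=\sum_i v^i\,\partial/\partial z^i$ is $$H(v)=\frac{\sum_{i,j,k,l} R_{i\bar jk\bar l}\,v^i\overline{v^j}v^k\overline{v^l}}{g(v,v)^2}.$$ The same notions are used for $(N,h)$. The holomorphic sectional curvature is called positive (non-negative, negative, non-positive) if $H(v)>0$ ($\ge 0$, $<0$, $\le 0$) for all points and all nonzero holomorphic tangent vectors $v$ there.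 Let $f:M\to N$ be a holomorphic map. (a) If $(M,g)$ has positive and $(N,h)$ has non-positive holomorphic sectional curvature, then $f$ is constant. (b) If $(M,g)$ has non-negative and $(N,h)$ has negative holomorphic sectional curvature, then $f$ is constant. -/

import Mathlib

open scoped Manifold ContDiff

noncomputable section

/-- The model space `ℂᵐ` of complex manifolds of dimension `m`. -/
abbrev CSpace (m : ℕ) : Type := EuclideanSpace ℂ (Fin m)

/-- The Wirtinger derivative `∂u/∂zⁱ = (∂u/∂xⁱ - √-1 ∂u/∂yⁱ) / 2` at `y`,
where `zⁱ = xⁱ + √-1 yⁱ`. -/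
def wirtinger {m : ℕ} (i : Fin m) (u : CSpace m → ℂ) (y : CSpace m) : ℂ :=
  (1 / 2 : ℂ) * (fderiv ℝ u y (EuclideanSpace.single i 1)
    - Complex.I * fderiv ℝ u y (EuclideanSpace.single i Complex.I))

/-- The conjugate Wirtinger derivative `∂u/∂z̄ⁱ = (∂u/∂xⁱ + √-1 ∂u/∂yⁱ) / 2` at `y`. -/
def wirtingerBar {m : ℕ} (i : Fin m) (u : CSpace m → ℂ) (y : CSpace m) : ℂ :=
  (1 / 2 : ℂ) * (fderiv ℝ u y (EuclideanSpace.single i 1)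
    + Complex.I * fderiv ℝ u y (EuclideanSpace.single i Complex.I))

/-- The coordinate vector field `∂/∂zⁱ` of the chart `φ`, at the point with coordinates `y`.
The complex vector space `TangentSpace 𝓘(ℂ, CSpace m) x` is the holomorphic tangent space
`T'ₓM`. -/
def coordVec {m : ℕ} {M : Type*} [TopologicalSpace M] [ChartedSpace (CSpace m) M]
    (φ : OpenPartialHomeomorph M (CSpace m)) (i : Fin m) (y : CSpace m) :
    TangentSpace 𝓘(ℂ, CSpace m) (φ.symm y) :=
  mfderiv 𝓘(ℂ, CSpace m) 𝓘(ℂ, CSpace m) φ.symm y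
    (EuclideanSpace.single i (1 : ℂ) : CSpace m)

/-- The components of a tangent vector `v` at `x` in the chart `φ`: `v = ∑ᵢ vⁱ ∂/∂zⁱ`. -/
def coordComp {m : ℕ} {M : Type*} [TopologicalSpace M] [ChartedSpace (CSpace m) M]
    (φ : OpenPartialHomeomorph M (CSpace m)) (x : M)
    (v : TangentSpace 𝓘(ℂ, CSpace m) x) : CSpace m :=
  mfderiv 𝓘(ℂ, CSpace m) 𝓘(ℂ, CSpace m) φ x v

/-- A (smooth) Hermitian metric on a complex manifold `M` of dimension `m`: a positive definite
Hermitian form on each holomorphic tangent space, complex linear in the first variable and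
conjugate linear in the second one, whose components `g_{i j̄}` are `C^∞` (in the real sense)
in each chart. -/
structure HermitianMetric (m : ℕ) (M : Type*) [TopologicalSpace M]
    [ChartedSpace (CSpace m) M] where
  /-- The Hermitian form on the tangent space at `x`. -/
  form (x : M) : TangentSpace 𝓘(ℂ, CSpace m) x →ₗ[ℂ]
    TangentSpace 𝓘(ℂ, CSpace m) x →ₗ⋆[ℂ] ℂ
  conj_symm (x : M) (v w : TangentSpace 𝓘(ℂ, CSpace m) x) :
    form x w v = (starRingEnd ℂ) (form x v w)
  pos (x : M) (v : TangentSpace 𝓘(ℂ, CSpace m) x) (hv : v ≠ 0) : 0 < (form x v v).re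
  smooth (φ : OpenPartialHomeomorph M (CSpace m)) (hφ : φ ∈ atlas (CSpace m) M)
    (i j : Fin m) :
    ContDiffOn ℝ ∞ (fun y => form (φ.symm y) (coordVec φ i y) (coordVec φ j y)) φ.target

namespace HermitianMetric

variable {m : ℕ} {M : Type*} [TopologicalSpace M] [ChartedSpace (CSpace m) M]

/-- The components `g_{i j̄} = g(∂/∂zⁱ, ∂/∂zʲ)` of the metric in the chart `φ`, as functions
of the coordinates. -/
def comp (g : HermitianMetric m M) (φ : OpenPartialHomeomorph M (CSpace m))
    (i j : Fin m) (y : CSpace m) : ℂ :=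
  g.form (φ.symm y) (coordVec φ i y) (coordVec φ j y)

/-- The components `g^{p q̄}` of the inverse metric: `∑_q g^{p q̄} g_{k q̄} = δ_{p k}`.
As `g_{k q̄}` is the entry `(k, q)` of the matrix of `g`, this is the entry `(q, p)` of the
inverse matrix. -/
def invComp (g : HermitianMetric m M) (φ : OpenPartialHomeomorph M (CSpace m))
    (p q : Fin m) (y : CSpace m) : ℂ :=
  (Matrix.of fun k l : Fin m => g.comp φ k l y)⁻¹ q p

/-- The components of the curvature tensor of the Chern connection in the chart `φ`:
`R_{i j̄ k l̄} = - ∂²g_{k l̄}/∂zⁱ∂z̄ʲ + ∑_{p,q} g^{p q̄} (∂g_{k q̄}/∂zⁱ) (∂g_{p l̄}/∂z̄ʲ)`. -/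
def chernCurvature (g : HermitianMetric m M) (φ : OpenPartialHomeomorph M (CSpace m))
    (i j k l : Fin m) (y : CSpace m) : ℂ :=
  - wirtinger i (wirtingerBar j (g.comp φ k l)) y
    + ∑ p, ∑ q, g.invComp φ p q y
        * wirtinger i (g.comp φ k q) y * wirtingerBar j (g.comp φ p l) y

/-- `R(v, v̄, v, v̄) = ∑ R_{i j̄ k l̄} vⁱ v̄ʲ vᵏ v̄ˡ` for a tangent vector `v` at `x`. It is
computed in the preferred chart at `x`; since `R` is a tensor, any chart gives the same value. -/
def curvatureForm (g : HermitianMetric m M) (x : M)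
    (v : TangentSpace 𝓘(ℂ, CSpace m) x) : ℂ :=
  let φ := chartAt (CSpace m) x
  let c := coordComp φ x v
  ∑ i, ∑ j, ∑ k, ∑ l, g.chernCurvature φ i j k l (φ x)
    * c i * (starRingEnd ℂ) (c j) * c k * (starRingEnd ℂ) (c l)

/-- The holomorphic sectional curvature `H(v) = R(v, v̄, v, v̄) / g(v, v)²` in the direction of
a nonzero tangent vector `v`. (Both `R(v, v̄, v, v̄)` and `g(v, v)` are real numbers.) -/
def holSecCurv (g : HermitianMetric m M) (x : M) (v : TangentSpace 𝓘(ℂ, CSpace m) x) : ℝ :=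
  (g.curvatureForm x v).re / (g.form x v v).re ^ 2

/-- The holomorphic sectional curvature is positive. -/
def PosHSC (g : HermitianMetric m M) : Prop :=
  ∀ (x : M) (v : TangentSpace 𝓘(ℂ, CSpace m) x), v ≠ 0 → 0 < g.holSecCurv x v

/-- The holomorphic sectional curvature is non-negative. -/
def NonnegHSC (g : HermitianMetric m M) : Prop :=
  ∀ (x : M) (v : TangentSpace 𝓘(ℂ, CSpace m) x), v ≠ 0 → 0 ≤ g.holSecCurv x v

/-- The holomorphic sectional curvature is negative. -/
def NegHSC (g : HermitianMetric m M) : Prop :=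
  ∀ (x : M) (v : TangentSpace 𝓘(ℂ, CSpace m) x), v ≠ 0 → g.holSecCurv x v < 0

/-- The holomorphic sectional curvature is non-positive. -/
def NonposHSC (g : HermitianMetric m M) : Prop :=
  ∀ (x : M) (v : TangentSpace 𝓘(ℂ, CSpace m) x), v ≠ 0 → g.holSecCurv x v ≤ 0

end HermitianMetric

end

/-!
Suppose that the holomorphic map `f` is not constant. As `M` is compact, the ratio
`h(df(v), df(v)) / g(v, v)` attains a maximum `C > 0` at some nonzero tangent vector `v`. Let `γ`
be a holomorphic curve with velocity `v` and vanishing covariant acceleration at time `0`. Then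
`C |γ'|² - |(f ∘ γ)'|²` is non-negative and vanishes at `0`, so its `∂²/∂z∂z̄` is non-negative
there. For a holomorphic curve, `∂²/∂z∂z̄` of the squared length of the velocity is the squared
length of the covariant acceleration minus `R(v, v̄, v, v̄)`. Hence `C R_g(v) ≤ R_h(df(v))`, and
dividing by `C g(v, v)²` gives `H_g(v) ≤ C H_h(df(v))`, which the signs of the curvatures forbid.
-/

open Filter Topology
open scoped ComplexConjugate Matrix

noncomputable section

section SecondOrder

open scoped RealInnerProductSpace

lemma nonneg_of_isLocalMin_of_hasDerivAt {f f' : ℝ → ℝ} {f'' x : ℝ} (hmin : IsLocalMin f x)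
    (hf : ∀ᶠ s in 𝓝 x, HasDerivAt f (f' s) s) (hf' : HasDerivAt f' f'' x) : 0 ≤ f'' := by
  by_contra! hneg
  have hderiv : deriv f =ᶠ[𝓝 x] f' := hf.mono fun s hs => hs.deriv
  have hdd : deriv (deriv f) x = f'' := by rw [hderiv.deriv_eq, hf'.deriv]
  have hmax : IsLocalMax f x := isLocalMax_of_deriv_deriv_neg (by rwa [hdd])
    hmin.deriv_eq_zero hf.self_of_nhds.continuousAt
  have hconst : f =ᶠ[𝓝 x] fun _ => f x := by
    filter_upwards [hmin, hmax] with s h₁ h₂ using le_antisymm h₂ h₁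
  have : deriv (deriv f) x = 0 := by simp [hconst.deriv.deriv_eq]
  linarith

lemma inner_apply_self_nonneg_of_isLocalMin {E : Type*} [NormedAddCommGroup E]
    [InnerProductSpace ℝ E] [CompleteSpace E] {f : E → ℝ} {f' : E → E} {f'' : E →L[ℝ] E} {x : E}
    (hmin : IsLocalMin f x) (hf : ∀ᶠ y in 𝓝 x, HasGradientAt f (f' y) y)
    (hf' : HasFDerivAt f' f'' x) (e : E) : 0 ≤ ⟪f'' e, e⟫ := by
  have hline (s : ℝ) : HasDerivAt (fun s : ℝ => x + s • e) e s := by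
    simpa using ((hasDerivAt_id s).smul_const e).const_add x
  have hx : x + (0 : ℝ) • e = x := by simp
  have htendsto : Tendsto (fun s : ℝ => x + s • e) (𝓝 0) (𝓝 x) := by
    simpa only [hx] using (hline 0).continuousAt.tendsto
  refine nonneg_of_isLocalMin_of_hasDerivAt (f := fun s => f (x + s • e))
    (f' := fun s => ⟪f' (x + s • e), e⟫) (x := 0) ?_ ?_ ?_
  · simpa only [IsLocalMin, IsMinFilter, hx] using htendsto.eventually hmin
  · filter_upwards [htendsto.eventually hf] with s hs
    simpa [Function.comp_def] using hs.hasFDerivAt.comp_hasDerivAt s (hline s)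
  · have hcomp : HasDerivAt (fun s : ℝ => f' (x + s • e)) (f'' e) 0 :=
      HasFDerivAt.comp_hasDerivAt 0 (by rwa [hx]) (hline 0)
    simpa using hcomp.inner ℝ (hasDerivAt_const 0 e)

end SecondOrder

/-- The Wirtinger derivatives of a function of one complex variable: `u` is real differentiable
at `t`, with `∂u/∂z = p` and `∂u/∂z̄ = q`, that is, `du = p dz + q dz̄`. -/
def HasWirtingerAt (u : ℂ → ℂ) (p q t : ℂ) : Prop :=
  HasFDerivAt u (p • ContinuousLinearMap.id ℝ ℂ + q • (Complex.conjCLE : ℂ →L[ℝ] ℂ)) t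

namespace HasWirtingerAt

variable {u v : ℂ → ℂ} {p q p' q' t : ℂ}

lemma of_hasFDerivAt {L : ℂ →L[ℝ] ℂ} (hu : HasFDerivAt u L t)
    (hL : ∀ ξ, L ξ = p * ξ + q * conj ξ) : HasWirtingerAt u p q t :=
  hu.congr_fderiv (by ext ξ; simp [hL])

lemma of_hasDerivAt (hu : HasDerivAt u p t) : HasWirtingerAt u p 0 t :=
  of_hasFDerivAt (hu.hasFDerivAt.restrictScalars ℝ) fun ξ => by simp [mul_comm]

lemma conj_comp (hu : HasWirtingerAt u p q t) :
    HasWirtingerAt (fun z => conj (u z)) (conj q) (conj p) t :=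
  of_hasFDerivAt ((Complex.conjCLE : ℂ →L[ℝ] ℂ).hasFDerivAt.comp t hu)
    fun ξ => by simp [add_comm]

lemma add (hu : HasWirtingerAt u p q t) (hv : HasWirtingerAt v p' q' t) :
    HasWirtingerAt (fun z => u z + v z) (p + p') (q + q') t :=
  of_hasFDerivAt (HasFDerivAt.add hu hv) fun ξ => by
    simp only [add_apply, smul_apply, ContinuousLinearMap.id_apply, smul_eq_mul,
      ContinuousLinearEquiv.coe_coe, Complex.conjCLE_apply]
    ring

lemma sub (hu : HasWirtingerAt u p q t) (hv : HasWirtingerAt v p' q' t) :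
    HasWirtingerAt (fun z => u z - v z) (p - p') (q - q') t :=
  of_hasFDerivAt (HasFDerivAt.sub hu hv) fun ξ => by
    simp only [sub_apply, add_apply, smul_apply, ContinuousLinearMap.id_apply, smul_eq_mul,
      ContinuousLinearEquiv.coe_coe, Complex.conjCLE_apply]
    ring

lemma mul (hu : HasWirtingerAt u p q t) (hv : HasWirtingerAt v p' q' t) :
    HasWirtingerAt (fun z => u z * v z) (p * v t + u t * p') (q * v t + u t * q') t :=
  of_hasFDerivAt (HasFDerivAt.mul hu hv) fun ξ => by
    simp only [add_apply, smul_apply, ContinuousLinearMap.id_apply, smul_eq_mul,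
      ContinuousLinearEquiv.coe_coe, Complex.conjCLE_apply]
    ring

lemma const_mul (c : ℂ) (hu : HasWirtingerAt u p q t) :
    HasWirtingerAt (fun z => c * u z) (c * p) (c * q) t :=
  of_hasFDerivAt (HasFDerivAt.const_mul hu c) fun ξ => by
    simp only [add_apply, smul_apply, ContinuousLinearMap.id_apply, smul_eq_mul,
      ContinuousLinearEquiv.coe_coe, Complex.conjCLE_apply]
    ring

lemma sum {ι : Type*} {s : Finset ι} {u : ι → ℂ → ℂ} {p q : ι → ℂ}
    (hu : ∀ i ∈ s, HasWirtingerAt (u i) (p i) (q i) t) :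
    HasWirtingerAt (fun z => ∑ i ∈ s, u i z) (∑ i ∈ s, p i) (∑ i ∈ s, q i) t :=
  of_hasFDerivAt (HasFDerivAt.fun_sum hu)
    fun ξ => by simp [Finset.sum_add_distrib, Finset.sum_mul]

lemma unique (h : HasWirtingerAt u p q t) (h' : HasWirtingerAt u p' q' t) :
    p = p' ∧ q = q' := by
  have hL := HasFDerivAt.unique h h'
  have h₁ : p + q = p' + q' := by simpa using DFunLike.congr_fun hL 1
  have h₂ : p - q = p' - q' := by
    have h := DFunLike.congr_fun hL Complex.I
    simp only [add_apply, smul_apply,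
      ContinuousLinearMap.id_apply, ContinuousLinearEquiv.coe_coe, Complex.conjCLE_apply,
      Complex.conj_I, smul_eq_mul] at h
    exact mul_right_cancel₀ Complex.I_ne_zero (by linear_combination h)
  exact ⟨by linear_combination (h₁ + h₂) / 2, by linear_combination (h₁ - h₂) / 2⟩

lemma hasGradientAt {f : ℂ → ℝ} {p q t : ℂ} (hf : HasWirtingerAt (fun z => (f z : ℂ)) p q t) :
    HasGradientAt f (2 * q) t := by
  have hp : p = conj q := (hf.unique (by simpa using hf.conj_comp)).1
  refine hasGradientAt_iff_hasFDerivAt.mpr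
    ((Complex.reCLM.hasFDerivAt.comp t hf).congr_fderiv (ContinuousLinearMap.ext fun ξ => ?_))
  simp [hp, Complex.inner, mul_comm, mul_two, add_add_add_comm]

end HasWirtingerAt

lemma re_nonneg_of_isLocalMin {f : ℂ → ℝ} {q : ℂ → ℂ} {r s t : ℂ} (hmin : IsLocalMin f t)
    (hf : ∀ᶠ z in 𝓝 t, HasGradientAt f (2 * q z) z) (hq : HasWirtingerAt q r s t) :
    0 ≤ r.re := by
  have hinner := inner_apply_self_nonneg_of_isLocalMin hmin hf (hq.const_mul 2)
  have h₁ : 0 ≤ 2 * r.re + 2 * s.re :=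
    (hinner 1).trans_eq (by simp [Complex.inner])
  have hI : 0 ≤ 2 * r.re - 2 * s.re :=
    (hinner Complex.I).trans_eq (by simp [Complex.inner, two_mul, sub_eq_add_neg, add_comm])
  linarith

section Wirtinger

variable {m : ℕ}

/-- The derivative `∂ᵥu = ∑ᵢ vⁱ ∂u/∂zⁱ` in the direction of the holomorphic tangent
vector `v`. -/
def wirtingerDir (v : CSpace m) (u : CSpace m → ℂ) (y : CSpace m) : ℂ :=
  ∑ i, wirtinger i u y * v i

/-- The derivative `∂̄ᵥu = ∑ⱼ v̄ʲ ∂u/∂z̄ʲ` in the direction of the antiholomorphic tangent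
vector `v̄`. -/
def wirtingerBarDir (v : CSpace m) (u : CSpace m → ℂ) (y : CSpace m) : ℂ :=
  ∑ j, wirtingerBar j u y * conj (v j)

/-- The Levi form `∑ᵢⱼ vⁱ v̄ʲ ∂²u/∂zⁱ∂z̄ʲ` of `u`. -/
def leviForm (u : CSpace m → ℂ) (y v : CSpace m) : ℂ :=
  ∑ i, ∑ j, wirtinger i (wirtingerBar j u) y * v i * conj (v j)

lemma fderiv_apply_eq_wirtingerDir_add (u : CSpace m → ℂ) (y v : CSpace m) :
    fderiv ℝ u y v = wirtingerDir v u y + wirtingerBarDir v u y := by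
  have hv : v = ∑ i, ((v i).re • EuclideanSpace.single i (1 : ℂ)
      + (v i).im • EuclideanSpace.single i Complex.I) := by
    ext k
    simp [WithLp.ofLp_sum, Finset.sum_add_distrib, Pi.single_apply]
  conv_lhs => rw [hv]
  rw [map_sum, wirtingerDir, wirtingerBarDir, ← Finset.sum_add_distrib]
  refine Finset.sum_congr rfl fun i _ => ?_
  have hre := Complex.re_eq_add_conj (v i)
  have him := Complex.im_eq_sub_conj (v i)
  simp only [map_add, map_smul, Complex.real_smul, wirtinger, wirtingerBar, hre, him]
  field_simp
  linear_combination
    ((v i - conj (v i)) * fderiv ℝ u y (EuclideanSpace.single i Complex.I)) * Complex.I_mul_I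

lemma conj_wirtinger (i : Fin m) (u : CSpace m → ℂ) (y : CSpace m) :
    conj (wirtinger i u y) = wirtingerBar i (fun z => conj (u z)) y := by
  have hconj (v : CSpace m) : fderiv ℝ (fun z => conj (u z)) y v = conj (fderiv ℝ u y v) := by
    simpa [Function.comp_def] using
      DFunLike.congr_fun (Complex.conjCLE.comp_fderiv (f := u) (x := y)) v
  simp [wirtinger, wirtingerBar, hconj, Complex.conj_ofNat]

lemma conj_wirtingerDir (v : CSpace m) (u : CSpace m → ℂ) (y : CSpace m) :
    conj (wirtingerDir v u y) = wirtingerBarDir v (fun z => conj (u z)) y := by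
  simp only [wirtingerDir, wirtingerBarDir, map_sum, map_mul, conj_wirtinger]

variable {u : CSpace m → ℂ} {σ τ : ℂ → CSpace m} {σ' τ' : CSpace m} {t : ℂ}

lemma hasWirtingerAt_comp (hu : DifferentiableAt ℝ u (σ t)) (hσ : HasDerivAt σ σ' t) :
    HasWirtingerAt (fun z => u (σ z)) (wirtingerDir σ' u (σ t)) (wirtingerBarDir σ' u (σ t)) t := by
  refine .of_hasFDerivAt (hu.hasFDerivAt.comp t (hσ.hasFDerivAt.restrictScalars ℝ)) fun ξ => ?_
  simp only [ContinuousLinearMap.comp_apply, ContinuousLinearMap.coe_restrictScalars',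
    ContinuousLinearMap.toSpanSingleton_apply, fderiv_apply_eq_wirtingerDir_add, wirtingerDir,
    wirtingerBarDir, Finset.sum_mul, PiLp.smul_apply, smul_eq_mul, map_mul]
  congr 1 <;> refine Finset.sum_congr rfl fun i _ => by ring

lemma exists_hasWirtingerAt_wirtingerBarDir
    (hu : ∀ j, DifferentiableAt ℝ (wirtingerBar j u) (σ t)) (hσ : HasDerivAt σ (τ t) t)
    (hτ : HasDerivAt τ τ' t) :
    ∃ q, HasWirtingerAt (fun z => wirtingerBarDir (τ z) u (σ z)) (leviForm u (σ t) (τ t)) q t := by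
  have hcoord (j : Fin m) : HasDerivAt (fun z => τ z j) (τ' j) t :=
    (EuclideanSpace.proj (𝕜 := ℂ) j).hasFDerivAt.comp_hasDerivAt t hτ
  have hsum := HasWirtingerAt.sum (s := Finset.univ) fun j _ =>
    (hasWirtingerAt_comp (hu j) hσ).mul (HasWirtingerAt.of_hasDerivAt (hcoord j)).conj_comp
  have hlevi : leviForm u (σ t) (τ t) = ∑ j, (wirtingerDir (τ t) (wirtingerBar j u) (σ t)
      * conj (τ t j) + wirtingerBar j u (σ t) * conj 0) := by
    simp only [map_zero, mul_zero, add_zero, leviForm, wirtingerDir, Finset.sum_mul]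
    exact Finset.sum_comm
  exact ⟨_, hlevi ▸ hsum⟩

lemma differentiableAt_wirtingerBar {y : CSpace m} (hu : ContDiffAt ℝ 2 u y) (j : Fin m) :
    DifferentiableAt ℝ (wirtingerBar j u) y := by
  have : DifferentiableAt ℝ (fderiv ℝ u) y :=
    (hu.fderiv_right (m := 1) le_rfl).differentiableAt one_ne_zero
  unfold wirtingerBar
  fun_prop

end Wirtinger

section SesqForm

open Matrix

variable {ι : Type*} [Fintype ι]

/-- The sesquilinear form `∑ₖₗ Aₖₗ vᵏ w̄ˡ`, conjugate linear in the second variable. -/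
def sesqForm (A : Matrix ι ι ℂ) (v w : EuclideanSpace ℂ ι) : ℂ :=
  v.ofLp ⬝ᵥ A *ᵥ star w.ofLp

variable (A B : Matrix ι ι ℂ) (u v w : EuclideanSpace ℂ ι)

lemma sesqForm_eq_sum : sesqForm A v w = ∑ k, ∑ l, A k l * v k * conj (w l) := by
  simp only [sesqForm, dotProduct, mulVec, Finset.mul_sum, Pi.star_apply]
  exact Finset.sum_congr rfl fun k _ => Finset.sum_congr rfl fun l _ => by
    rw [← mul_assoc, mul_comm (v k), starRingEnd_apply]

lemma sesqForm_add_left : sesqForm A (u + v) w = sesqForm A u w + sesqForm A v w := by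
  simp [sesqForm, add_dotProduct]

lemma sesqForm_add_right : sesqForm A u (v + w) = sesqForm A u v + sesqForm A u w := by
  simp [sesqForm, mulVec_add, dotProduct_add]

lemma conj_sesqForm : conj (sesqForm A v w) = sesqForm Aᴴ w v := by
  rw [sesqForm, starRingEnd_apply, dotProduct_mulVec, ← dotProduct_star, star_vecMul, sesqForm]

lemma HasWirtingerAt.sesqForm {A : ℂ → Matrix ι ι ℂ} {P Q : Matrix ι ι ℂ}
    {v w : ℂ → EuclideanSpace ℂ ι} {v' w' : EuclideanSpace ℂ ι} {t : ℂ}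
    (hA : ∀ k l, HasWirtingerAt (fun z => A z k l) (P k l) (Q k l) t)
    (hv : HasDerivAt v v' t) (hw : HasDerivAt w w' t) :
    HasWirtingerAt (fun z => sesqForm (A z) (v z) (w z))
      (sesqForm P (v t) (w t) + sesqForm (A t) v' (w t))
      (sesqForm Q (v t) (w t) + sesqForm (A t) (v t) w') t := by
  have hcoord {x : ℂ → EuclideanSpace ℂ ι} {x' : EuclideanSpace ℂ ι} (hx : HasDerivAt x x' t)
      (i : ι) : HasWirtingerAt (fun z => x z i) (x' i) 0 t :=
    .of_hasDerivAt ((EuclideanSpace.proj (𝕜 := ℂ) i).hasFDerivAt.comp_hasDerivAt t hx)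
  have hsum := HasWirtingerAt.sum (s := Finset.univ) fun k _ =>
    HasWirtingerAt.sum (s := Finset.univ) fun l _ =>
      ((hA k l).mul (hcoord hv k)).mul (hcoord hw l).conj_comp
  convert hsum using 1
  all_goals simp [sesqForm_eq_sum, Finset.sum_add_distrib, add_mul]

variable [DecidableEq ι]

variable {A} in
lemma sesqForm_vecMul_inv (hA : IsUnit A) :
    sesqForm A (WithLp.toLp 2 (v.ofLp ᵥ* (B * A⁻¹))) w = sesqForm B v w := by
  rw [sesqForm, ← dotProduct_mulVec, mulVec_mulVec,
    nonsing_inv_mul_cancel_right _ _ ((isUnit_iff_isUnit_det A).mp hA)]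
  rfl

variable {A} in
lemma sesqForm_add_vecMul_inv_self (hA : A.IsHermitian) (hu : IsUnit A) :
    sesqForm A (u + WithLp.toLp 2 (v.ofLp ᵥ* (B * A⁻¹))) (u + WithLp.toLp 2 (v.ofLp ᵥ* (B * A⁻¹)))
      = sesqForm A u u + sesqForm B v u + sesqForm Bᴴ u v + sesqForm (B * A⁻¹ * Bᴴ) v v := by
  set c : EuclideanSpace ℂ ι := WithLp.toLp 2 (v.ofLp ᵥ* (B * A⁻¹)) with hc
  have hleft (w) : sesqForm A c w = sesqForm B v w := sesqForm_vecMul_inv B v w hu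
  have hright : sesqForm A u c = sesqForm Bᴴ u v := by
    rw [← conj_sesqForm, ← hleft, conj_sesqForm, hA.eq]
  have hsq : sesqForm A c c = sesqForm (B * A⁻¹ * Bᴴ) v v := by
    have hreal : sesqForm A c c = conj (sesqForm A c c) := by rw [conj_sesqForm, hA.eq]
    rw [hreal, hleft, conj_sesqForm]
    simp only [sesqForm, hc, ← dotProduct_mulVec, mulVec_mulVec]
  rw [sesqForm_add_left, sesqForm_add_right, sesqForm_add_right, hleft, hright, hsq]
  ring

end SesqForm

lemma sum_sum_sum_sum_comm {ι κ R : Type*} [Fintype ι] [Fintype κ] [AddCommMonoid R]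
    (f : ι → ι → κ → κ → R) :
    ∑ i, ∑ j, ∑ k, ∑ l, f i j k l = ∑ k, ∑ l, ∑ i, ∑ j, f i j k l := by
  simpa only [Fintype.sum_prod_type] using Finset.sum_comm (s := Finset.univ) (t := Finset.univ)
    (f := fun (x : ι × ι) (y : κ × κ) => f x.1 x.2 y.1 y.2)

section Chart

variable {m : ℕ} {M : Type*} [TopologicalSpace M] [ChartedSpace (CSpace m) M]

namespace HermitianMetric

section Coordinates

variable (g : HermitianMetric m M) (φ : OpenPartialHomeomorph M (CSpace m)) (y v w : CSpace m)

/-- The Gram matrix `(g_{k l̄})` of the coordinate vector fields. -/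
def gram : Matrix (Fin m) (Fin m) ℂ :=
  .of fun k l => g.comp φ k l y

/-- The matrix `(∂ᵥ g_{k l̄})` of first derivatives of the metric. -/
def gramDeriv : Matrix (Fin m) (Fin m) ℂ :=
  .of fun k l => wirtingerDir v (g.comp φ k l) y

/-- The matrix `(∂ᵥ ∂̄ᵥ g_{k l̄})` of second derivatives of the metric. -/
def gramLevi : Matrix (Fin m) (Fin m) ℂ :=
  .of fun k l => leviForm (g.comp φ k l) y v

/-- The squared length of the tangent vector with coordinates `v`. -/
def coordNormSq : ℝ :=
  (sesqForm (g.gram φ y) v v).re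

/-- The vector `∑ Γᵖ_{i k} vⁱ vᵏ`, where `Γᵖ_{i k} = ∑ g^{p q̄} ∂g_{k q̄}/∂zⁱ` are the Christoffel
symbols of the Chern connection. -/
def christoffel : CSpace m :=
  WithLp.toLp 2 (v.ofLp ᵥ* (g.gramDeriv φ y v * (g.gram φ y)⁻¹))

/-- The curvature `R(v, v̄, v, v̄)` in the coordinates of an arbitrary chart. -/
def coordCurvature : ℂ :=
  sesqForm (g.gramDeriv φ y v * (g.gram φ y)⁻¹ * (g.gramDeriv φ y v)ᴴ) v v
    - sesqForm (g.gramLevi φ y v) v v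

lemma gram_isHermitian : (g.gram φ y).IsHermitian :=
  Matrix.IsHermitian.ext fun k l => (g.conj_symm (φ.symm y) (coordVec φ l y) (coordVec φ k y)).symm

lemma ofReal_coordNormSq : (g.coordNormSq φ y v : ℂ) = sesqForm (g.gram φ y) v v :=
  Complex.conj_eq_iff_re.mp (by rw [conj_sesqForm, (g.gram_isHermitian φ y).eq])

lemma conjTranspose_gramDeriv_apply (k l : Fin m) :
    (g.gramDeriv φ y v)ᴴ k l = wirtingerBarDir v (g.comp φ k l) y := by
  have hconj : (fun z => conj (g.comp φ l k z)) = g.comp φ k l :=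
    funext fun z => (g.conj_symm (φ.symm z) (coordVec φ l z) (coordVec φ k z)).symm
  rw [← hconj, ← conj_wirtingerDir]
  rfl

lemma sum_chernCurvature_eq_coordCurvature :
    ∑ i, ∑ j, ∑ k, ∑ l, g.chernCurvature φ i j k l y * v i * conj (v j) * v k * conj (v l)
      = g.coordCurvature φ y v := by
  have hlevi (k l : Fin m) : ∑ i, ∑ j,
      wirtinger i (wirtingerBar j (g.comp φ k l)) y * v i * conj (v j) = g.gramLevi φ y v k l := rfl
  have hchristoffel (k l : Fin m) : ∑ i, ∑ j, (∑ p, ∑ q, g.invComp φ p q y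
        * wirtinger i (g.comp φ k q) y * wirtingerBar j (g.comp φ p l) y) * v i * conj (v j)
      = (g.gramDeriv φ y v * (g.gram φ y)⁻¹ * (g.gramDeriv φ y v)ᴴ) k l := by
    have hinv (p q : Fin m) : g.invComp φ p q y = (g.gram φ y)⁻¹ q p := rfl
    simp only [Matrix.mul_apply, conjTranspose_gramDeriv_apply]
    simp only [gramDeriv, Matrix.of_apply, wirtingerDir, wirtingerBarDir, Finset.sum_mul, hinv]
    rw [sum_sum_sum_sum_comm]
    refine Finset.sum_congr rfl fun p _ => Finset.sum_congr rfl fun q _ =>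
      Finset.sum_congr rfl fun i _ => ?_
    rw [Finset.mul_sum]
    exact Finset.sum_congr rfl fun j _ => by ring
  rw [sum_sum_sum_sum_comm, coordCurvature, sesqForm_eq_sum, sesqForm_eq_sum]
  simp only [← hlevi, ← hchristoffel, chernCurvature, add_mul, neg_mul, Finset.sum_add_distrib,
    Finset.sum_neg_distrib, Finset.sum_mul]
  rw [neg_add_eq_sub]

lemma curvatureForm_eq_coordCurvature (x : M) (v : TangentSpace 𝓘(ℂ, CSpace m) x) :
    g.curvatureForm x v = g.coordCurvature (chartAt (CSpace m) x) (chartAt (CSpace m) x x)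
      (coordComp (chartAt (CSpace m) x) x v) :=
  g.sum_chernCurvature_eq_coordCurvature _ _ _

lemma sesqForm_gram : sesqForm (g.gram φ y) v w = g.form (φ.symm y)
    (mfderiv 𝓘(ℂ, CSpace m) 𝓘(ℂ, CSpace m) φ.symm y v)
    (mfderiv 𝓘(ℂ, CSpace m) 𝓘(ℂ, CSpace m) φ.symm y w) := by
  have hsum (v : CSpace m) : mfderiv 𝓘(ℂ, CSpace m) 𝓘(ℂ, CSpace m) φ.symm y v
      = ∑ i, v i • coordVec φ i y := by
    have hv : v = ∑ i, v i • (EuclideanSpace.single i 1 : CSpace m) := by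
      ext k
      simp [WithLp.ofLp_sum, Pi.single_apply]
    conv_lhs => rw [hv]
    exact (map_sum _ _ _).trans (Finset.sum_congr rfl fun i _ => map_smul _ _ _)
  rw [hsum v, hsum w, sesqForm_eq_sum, map_sum (g.form (φ.symm y)), LinearMap.sum_apply]
  refine Finset.sum_congr rfl fun k _ => ?_
  rw [map_sum]
  refine Finset.sum_congr rfl fun l _ => ?_
  rw [(g.form (φ.symm y)).map_smul, LinearMap.smul_apply, LinearMap.map_smulₛₗ]
  simp only [smul_eq_mul, gram, comp, Matrix.of_apply]
  ring

lemma coordNormSq_eq : g.coordNormSq φ y v = (g.form (φ.symm y)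
    (mfderiv 𝓘(ℂ, CSpace m) 𝓘(ℂ, CSpace m) φ.symm y v)
    (mfderiv 𝓘(ℂ, CSpace m) 𝓘(ℂ, CSpace m) φ.symm y v)).re := by
  rw [coordNormSq, sesqForm_gram]

@[simp]
lemma coordNormSq_zero : g.coordNormSq φ y 0 = 0 := by
  simp [coordNormSq, sesqForm]

end Coordinates

variable (g : HermitianMetric m M) {φ : OpenPartialHomeomorph M (CSpace m)} {y v : CSpace m}

lemma contDiffAt_comp (hφ : φ ∈ atlas (CSpace m) M) (hy : y ∈ φ.target) (k l : Fin m) :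
    ContDiffAt ℝ ∞ (g.comp φ k l) y :=
  (g.smooth φ hφ k l).contDiffAt (φ.open_target.mem_nhds hy)

section Positivity

variable [IsManifold 𝓘(ℂ, CSpace m) 1 M]

lemma coordNormSq_pos (hφ : φ ∈ atlas (CSpace m) M) (hy : y ∈ φ.target) (hv : v ≠ 0) :
    0 < g.coordNormSq φ y v := by
  have hinj := (mdifferentiable_of_mem_atlas (I := 𝓘(ℂ, CSpace m)) hφ).symm.mfderiv_injective hy
  rw [coordNormSq_eq]
  exact g.pos _ _ fun h => hv (hinj (h.trans (map_zero _).symm))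

lemma coordNormSq_nonneg (hφ : φ ∈ atlas (CSpace m) M) (hy : y ∈ φ.target) (v : CSpace m) :
    0 ≤ g.coordNormSq φ y v := by
  rcases eq_or_ne v 0 with rfl | hv
  · rw [coordNormSq_zero]
  · exact (g.coordNormSq_pos hφ hy hv).le

open scoped ComplexOrder in
lemma isUnit_gram (hφ : φ ∈ atlas (CSpace m) M) (hy : y ∈ φ.target) : IsUnit (g.gram φ y) := by
  refine (Matrix.PosDef.of_dotProduct_mulVec_pos (g.gram_isHermitian φ y) fun x hx => ?_).isUnit
  have hv : (WithLp.toLp 2 (star x) : CSpace m) ≠ 0 := by simpa using hx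
  have hpos := Complex.zero_lt_real.mpr (g.coordNormSq_pos hφ hy hv)
  simpa only [ofReal_coordNormSq, sesqForm, star_star] using hpos

end Positivity

end HermitianMetric

end Chart

section Curve

variable {m : ℕ} {M : Type*} [TopologicalSpace M] [ChartedSpace (CSpace m) M]

namespace HermitianMetric

section

variable (g : HermitianMetric m M) (φ : OpenPartialHomeomorph M (CSpace m))
  (σ : ℂ → CSpace m) (t : ℂ)

/-- The covariant derivative, for the Chern connection, of the velocity of a holomorphic
curve. -/
def covAccel : CSpace m :=
  deriv (deriv σ) t + g.christoffel φ (σ t) (deriv σ t)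

/-- The derivative `∂/∂z̄` of the squared length of the velocity of a holomorphic curve. -/
def speedSqBar : ℂ :=
  sesqForm (g.gramDeriv φ (σ t) (deriv σ t))ᴴ (deriv σ t) (deriv σ t)
    + sesqForm (g.gram φ (σ t)) (deriv σ t) (deriv (deriv σ) t)

end

variable (g : HermitianMetric m M) {φ : OpenPartialHomeomorph M (CSpace m)}
  {σ : ℂ → CSpace m} {t : ℂ}

lemma hasWirtingerAt_gram (hφ : φ ∈ atlas (CSpace m) M) (hσ : AnalyticAt ℂ σ t)
    (ht : σ t ∈ φ.target) (k l : Fin m) :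
    HasWirtingerAt (fun z => g.gram φ (σ z) k l) (g.gramDeriv φ (σ t) (deriv σ t) k l)
      ((g.gramDeriv φ (σ t) (deriv σ t))ᴴ k l) t := by
  rw [conjTranspose_gramDeriv_apply]
  exact hasWirtingerAt_comp ((g.contDiffAt_comp hφ ht k l).differentiableAt (by simp))
    hσ.differentiableAt.hasDerivAt

lemma hasWirtingerAt_speedSq (hφ : φ ∈ atlas (CSpace m) M) (hσ : AnalyticAt ℂ σ t)
    (ht : σ t ∈ φ.target) :
    HasWirtingerAt (fun z => (g.coordNormSq φ (σ z) (deriv σ z) : ℂ))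
      (conj (g.speedSqBar φ σ t)) (g.speedSqBar φ σ t) t := by
  have hτ := hσ.deriv.differentiableAt.hasDerivAt
  simp only [ofReal_coordNormSq, speedSqBar, map_add, conj_sesqForm,
    Matrix.conjTranspose_conjTranspose, (g.gram_isHermitian φ (σ t)).eq]
  exact .sesqForm (g.hasWirtingerAt_gram hφ hσ ht) hτ hτ

lemma exists_hasWirtingerAt_speedSqBar [IsManifold 𝓘(ℂ, CSpace m) 1 M]
    (hφ : φ ∈ atlas (CSpace m) M) (hσ : AnalyticAt ℂ σ t) (ht : σ t ∈ φ.target) :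
    ∃ q, HasWirtingerAt (g.speedSqBar φ σ)
      (g.coordNormSq φ (σ t) (g.covAccel φ σ t) - g.coordCurvature φ (σ t) (deriv σ t)) q t := by
  have hσ' := hσ.differentiableAt.hasDerivAt
  have hτ := hσ.deriv.differentiableAt.hasDerivAt
  have hα := hσ.deriv.deriv.differentiableAt.hasDerivAt
  have hderiv (k l : Fin m) : ∃ q, HasWirtingerAt
      (fun z => (g.gramDeriv φ (σ z) (deriv σ z))ᴴ k l)
      (g.gramLevi φ (σ t) (deriv σ t) k l) q t := by
    simp only [conjTranspose_gramDeriv_apply]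
    exact exists_hasWirtingerAt_wirtingerBarDir (fun j => differentiableAt_wirtingerBar
      ((g.contDiffAt_comp hφ ht k l).of_le (by norm_cast)) j) hσ' hτ
  choose q hq using hderiv
  have hsum := (HasWirtingerAt.sesqForm (Q := .of q) hq hτ hτ).add
    (.sesqForm (g.hasWirtingerAt_gram hφ hσ ht) hτ hα)
  have hcurv : g.coordNormSq φ (σ t) (g.covAccel φ σ t) - g.coordCurvature φ (σ t) (deriv σ t)
      = sesqForm (g.gramLevi φ (σ t) (deriv σ t)) (deriv σ t) (deriv σ t)
        + sesqForm (g.gramDeriv φ (σ t) (deriv σ t))ᴴ (deriv (deriv σ) t) (deriv σ t)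
        + (sesqForm (g.gramDeriv φ (σ t) (deriv σ t)) (deriv σ t) (deriv (deriv σ) t)
          + sesqForm (g.gram φ (σ t)) (deriv (deriv σ) t) (deriv (deriv σ) t)) := by
    rw [ofReal_coordNormSq, covAccel, christoffel, sesqForm_add_vecMul_inv_self _ _ _
      (g.gram_isHermitian φ _) (g.isUnit_gram hφ ht), coordCurvature]
    ring
  exact ⟨_, hcurv ▸ hsum⟩

end HermitianMetric

end Curve

section Comparison

lemma exists_differentiable_deriv_eq {𝕜 E : Type*} [NontriviallyNormedField 𝕜] [NeZero (2 : 𝕜)]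
    [NormedAddCommGroup E] [NormedSpace 𝕜 E] (y c a : E) :
    ∃ γ : 𝕜 → E, Differentiable 𝕜 γ ∧ γ 0 = y ∧ deriv γ 0 = c ∧ deriv (deriv γ) 0 = a := by
  have hγ (t : 𝕜) : HasDerivAt (fun t : 𝕜 => y + t • c + (t ^ 2 / 2) • a) (c + t • a) t := by
    simpa [two_ne_zero] using (((hasDerivAt_id t).smul_const c).const_add y).fun_add
      (((hasDerivAt_pow 2 t).div_const 2).smul_const a)
  have hγ' : deriv (fun t : 𝕜 => y + t • c + (t ^ 2 / 2) • a) = fun t => c + t • a :=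
    funext fun t => (hγ t).deriv
  have hdd : HasDerivAt (fun t : 𝕜 => c + t • a) a 0 := by
    simpa using ((hasDerivAt_id (0 : 𝕜)).smul_const a).const_add c
  exact ⟨_, fun t => (hγ t).differentiableAt, by simp, by simp [hγ'], by rw [hγ', hdd.deriv]⟩

variable {m n : ℕ} {M : Type*} [TopologicalSpace M] [ChartedSpace (CSpace m) M]
  [IsManifold 𝓘(ℂ, CSpace m) 1 M]
  {N : Type*} [TopologicalSpace N] [ChartedSpace (CSpace n) N] [IsManifold 𝓘(ℂ, CSpace n) 1 N]
  (g : HermitianMetric m M) (h : HermitianMetric n N)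
  {φ : OpenPartialHomeomorph M (CSpace m)} {ψ : OpenPartialHomeomorph N (CSpace n)} {C : ℝ}

namespace HermitianMetric

lemma mul_re_coordCurvature_le_of_isLocalMin {γ : ℂ → CSpace m} {σ : ℂ → CSpace n} {t : ℂ}
    (hφ : φ ∈ atlas (CSpace m) M) (hψ : ψ ∈ atlas (CSpace n) N)
    (hγ : AnalyticAt ℂ γ t) (hσ : AnalyticAt ℂ σ t) (hγt : γ t ∈ φ.target) (hσt : σ t ∈ ψ.target)
    (hmin : IsLocalMin (fun z => C * g.coordNormSq φ (γ z) (deriv γ z)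
      - h.coordNormSq ψ (σ z) (deriv σ z)) t) (haccel : g.covAccel φ γ t = 0) :
    C * (g.coordCurvature φ (γ t) (deriv γ t)).re
      ≤ (h.coordCurvature ψ (σ t) (deriv σ t)).re := by
  have hgradient : ∀ᶠ z in 𝓝 t, HasGradientAt (fun z => C * g.coordNormSq φ (γ z) (deriv γ z)
      - h.coordNormSq ψ (σ z) (deriv σ z))
      (2 * ((C : ℂ) * g.speedSqBar φ γ z - h.speedSqBar ψ σ z)) z := by
    filter_upwards [hγ.eventually_analyticAt, hσ.eventually_analyticAt,
      hγ.continuousAt.eventually_mem (φ.open_target.mem_nhds hγt),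
      hσ.continuousAt.eventually_mem (ψ.open_target.mem_nhds hσt)] with z hγz hσz hγmem hσmem
    have hdiff := ((g.hasWirtingerAt_speedSq hφ hγz hγmem).const_mul C).sub
      (h.hasWirtingerAt_speedSq hψ hσz hσmem)
    simp only [← Complex.ofReal_mul, ← Complex.ofReal_sub] at hdiff
    exact hdiff.hasGradientAt
  obtain ⟨_, hg⟩ := g.exists_hasWirtingerAt_speedSqBar hφ hγ hγt
  obtain ⟨_, hh⟩ := h.exists_hasWirtingerAt_speedSqBar hψ hσ hσt
  have hnonneg := re_nonneg_of_isLocalMin hmin hgradient ((hg.const_mul C).sub hh)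
  have hpos := h.coordNormSq_nonneg hψ hσt (h.covAccel ψ σ t)
  simp only [haccel, coordNormSq_zero, Complex.sub_re, Complex.re_ofReal_mul, Complex.ofReal_re]
    at hnonneg
  linarith

lemma mul_re_coordCurvature_le_fderiv {F : CSpace m → CSpace n} {U : Set (CSpace m)}
    {y v : CSpace m} (hφ : φ ∈ atlas (CSpace m) M) (hψ : ψ ∈ atlas (CSpace n) N)
    (hU : IsOpen U) (hUφ : U ⊆ φ.target) (hF : DifferentiableOn ℂ F U)
    (hFU : Set.MapsTo F U ψ.target) (hy : y ∈ U)
    (hle : ∀ z ∈ U, ∀ w, h.coordNormSq ψ (F z) (fderiv ℂ F z w) ≤ C * g.coordNormSq φ z w)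
    (heq : h.coordNormSq ψ (F y) (fderiv ℂ F y v) = C * g.coordNormSq φ y v) :
    C * (g.coordCurvature φ y v).re ≤ (h.coordCurvature ψ (F y) (fderiv ℂ F y v)).re := by
  obtain ⟨γ, hγ, hγ₀, hγ₁, hγ₂⟩ :=
    exists_differentiable_deriv_eq (𝕜 := ℂ) y v (-g.christoffel φ y v)
  have hγU : ∀ᶠ z in 𝓝 0, γ z ∈ U :=
    hγ.continuous.continuousAt.eventually_mem (hU.mem_nhds (by rwa [hγ₀]))
  have hderiv (z : ℂ) (hz : γ z ∈ U) : HasDerivAt (F ∘ γ) (fderiv ℂ F (γ z) (deriv γ z)) z :=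
    (hF.differentiableAt (hU.mem_nhds hz)).hasFDerivAt.comp_hasDerivAt z (hγ z).hasDerivAt
  have hσ : AnalyticAt ℂ (F ∘ γ) 0 := Complex.analyticAt_iff_eventually_differentiableAt.mpr
    (hγU.mono fun z hz => (hderiv z hz).differentiableAt)
  have h₀ : γ 0 ∈ U := hγU.self_of_nhds
  have hmin : IsLocalMin (fun z => C * g.coordNormSq φ (γ z) (deriv γ z)
      - h.coordNormSq ψ ((F ∘ γ) z) (deriv (F ∘ γ) z)) 0 := by
    filter_upwards [hγU] with z hz
    simp only [(hderiv z hz).deriv, (hderiv 0 h₀).deriv, hγ₀, hγ₁, Function.comp_apply, heq,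
      sub_self, sub_nonneg]
    exact hle _ hz _
  have hcurv := g.mul_re_coordCurvature_le_of_isLocalMin h hφ hψ (hγ.analyticAt 0) hσ (hUφ h₀)
    (hFU h₀) hmin (by rw [covAccel, hγ₀, hγ₁, hγ₂, neg_add_cancel])
  rwa [(hderiv 0 h₀).deriv, Function.comp_apply, hγ₀, hγ₁] at hcurv

end HermitianMetric

end Comparison

lemma continuousOn_fderiv_of_differentiableOn {E E' : Type*} [NormedAddCommGroup E]
    [NormedSpace ℂ E] [FiniteDimensional ℂ E] [NormedAddCommGroup E'] [NormedSpace ℂ E']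
    [CompleteSpace E'] {F : E → E'} {U : Set E} (hF : DifferentiableOn ℂ F U) (hU : IsOpen U) :
    ContinuousOn (fderiv ℂ F) U := by
  -- The derivative along `e` at `y` is the derivative at `0` of the function `G y` of one complex
  -- variable, and derivatives of holomorphic functions converge with the functions.
  refine continuousOn_clm_apply.mpr fun e y₀ hy₀ => ContinuousAt.continuousWithinAt ?_
  have : ProperSpace E := FiniteDimensional.proper ℂ E
  set G : E → ℂ → E' := fun y t => F (y + t • e)
  have hline : Continuous fun p : E × ℂ => p.1 + p.2 • e := by fun_prop
  obtain ⟨⟨K, r⟩, ⟨⟨hK, hKc⟩, hr⟩, hKr⟩ :=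
    ((compact_basis_nhds y₀).prod_nhds (Metric.nhds_basis_closedBall (x := (0 : ℂ)))).mem_iff.mp
      (hline.continuousAt.preimage_mem_nhds (hU.mem_nhds (by simpa using hy₀)))
  have hG (y) (hy : y ∈ K) (t) (ht : t ∈ Metric.closedBall (0 : ℂ) r) :
      HasDerivAt (G y) (fderiv ℂ F (y + t • e) e) t := by
    have hmem : y + t • e ∈ U := hKr (Set.mk_mem_prod hy ht)
    refine (hF.differentiableAt (hU.mem_nhds hmem)).hasFDerivAt.comp_hasDerivAt t ?_
    simpa using ((hasDerivAt_id t).smul_const e).const_add y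
  have hG₀ (y) (hy : y ∈ K) : deriv (G y) 0 = fderiv ℂ F y e := by
    simpa using (hG y hy 0 (Metric.mem_closedBall_self hr.le)).deriv
  have huniform : TendstoUniformlyOn G (G y₀) (𝓝 y₀) (Metric.closedBall 0 r) := by
    rw [← nhdsWithin_eq_nhds.mpr hK]
    exact ((hKc.prod (isCompact_closedBall 0 r)).uniformContinuousOn_of_continuous
      (hF.continuousOn.comp hline.continuousOn hKr)).tendstoUniformlyOn (mem_of_mem_nhds hK)
  have hderiv : Tendsto (fun y => deriv (G y) 0) (𝓝 y₀) (𝓝 (deriv (G y₀) 0)) :=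
    ((huniform.mono Metric.ball_subset_closedBall).tendstoLocallyUniformlyOn.deriv
      (by filter_upwards [hK] with y hy t ht using (hG y hy t
        (Metric.ball_subset_closedBall ht)).differentiableAt.differentiableWithinAt)
      Metric.isOpen_ball).tendsto_at (Metric.mem_ball_self hr)
  rw [hG₀ y₀ (mem_of_mem_nhds hK)] at hderiv
  exact hderiv.congr' (by filter_upwards [hK] with y hy using hG₀ y hy)

lemma exists_forall_le_of_forall_eventually {X α : Type*} [TopologicalSpace X] [CompactSpace X]
    [Nonempty X] [LinearOrder α] {T : X → Type*} {ρ : ∀ x, T x → α}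
    (hρ : ∀ x₀, ∃ x v, ∀ᶠ y in 𝓝 x₀, ∀ w, ρ y w ≤ ρ x v) : ∃ x v, ∀ y w, ρ y w ≤ ρ x v := by
  choose x v hle using hρ
  obtain ⟨s, hs⟩ := CompactSpace.elim_nhds_subcover _ hle
  have hcover (y : X) : ∃ x₀ ∈ s, ∀ w, ρ y w ≤ ρ (x x₀) (v x₀) := by
    simpa using hs.ge (Set.mem_univ y)
  obtain ⟨x₀, hx₀, -⟩ := hcover (Classical.arbitrary X)
  obtain ⟨x₁, -, hmax⟩ := s.exists_max_image (fun x₀ => ρ (x x₀) (v x₀)) ⟨x₀, hx₀⟩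
  refine ⟨x x₁, v x₁, fun y w => ?_⟩
  obtain ⟨x₂, hx₂, hy⟩ := hcover y
  exact (hy w).trans (hmax x₂ hx₂)

lemma exists_eventually_le_of_continuousOn_prod {X E : Type*} [TopologicalSpace X]
    [LocallyCompactSpace X] [NormedAddCommGroup E] [NormedSpace ℝ E] [ProperSpace E]
    [Nontrivial E] {ρ : X → E → ℝ} {U : Set X} {x₀ : X} (hU : U ∈ 𝓝 x₀)
    (hcont : ContinuousOn (fun p : X × E => ρ p.1 p.2) (U ×ˢ {0}ᶜ))
    (hsmul : ∀ (x : X) (c : ℝ) (v : E), c ≠ 0 → ρ x (c • v) = ρ x v)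
    (hzero : ∀ x ∈ U, ∀ v, ρ x 0 ≤ ρ x v) :
    ∃ x ∈ U, ∃ v, ∀ᶠ y in 𝓝 x₀, ∀ w, ρ y w ≤ ρ x v := by
  obtain ⟨K, hK, hKU, hKc⟩ := LocallyCompactSpace.local_compact_nhds x₀ U hU
  have hsphere : (Metric.sphere (0 : E) 1).Nonempty := NormedSpace.sphere_nonempty.mpr zero_le_one
  have hsub : K ×ˢ Metric.sphere (0 : E) 1 ⊆ U ×ˢ {0}ᶜ :=
    Set.prod_mono hKU fun v hv => ne_zero_of_mem_unit_sphere ⟨v, hv⟩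
  obtain ⟨⟨x, v⟩, hxv, hmax⟩ := (hKc.prod (isCompact_sphere (0 : E) 1)).exists_isMaxOn
    (Set.Nonempty.prod ⟨x₀, mem_of_mem_nhds hK⟩ hsphere) (hcont.mono hsub)
  have hle {y : X} (hy : y ∈ K) {w : E} (hw : w ≠ 0) : ρ y w ≤ ρ x v := by
    have hnorm : ‖w‖⁻¹ ≠ 0 := inv_ne_zero (norm_ne_zero_iff.mpr hw)
    have hunit : ‖w‖⁻¹ • w ∈ Metric.sphere (0 : E) 1 := by
      simp [norm_smul, norm_ne_zero_iff.mpr hw]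
    rw [← hsmul y _ w hnorm]
    exact hmax (Set.mk_mem_prod hy hunit)
  refine ⟨x, hKU hxv.1, v, ?_⟩
  filter_upwards [hK] with y hy w
  obtain ⟨e, he⟩ := exists_ne (0 : E)
  rcases eq_or_ne w 0 with rfl | hw
  · exact (hzero y (hKU hy) e).trans (hle hy he)
  · exact hle hy hw

section ChartExpression

variable {E E' M N : Type*} [TopologicalSpace M] [TopologicalSpace N]

section

variable [TopologicalSpace E] [TopologicalSpace E']

/-- The domain of definition of the expression `ψ ∘ f ∘ φ⁻¹` of `f` in the charts `φ`, `ψ`. -/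
def coordDomain (φ : OpenPartialHomeomorph M E) (ψ : OpenPartialHomeomorph N E') (f : M → N) :
    Set E :=
  φ.target ∩ φ.symm ⁻¹' (f ⁻¹' ψ.source)

variable {φ : OpenPartialHomeomorph M E} {ψ : OpenPartialHomeomorph N E'} {f : M → N}

lemma isOpen_coordDomain (hf : Continuous f) : IsOpen (coordDomain φ ψ f) :=
  φ.isOpen_inter_preimage_symm (ψ.open_source.preimage hf)

lemma mem_coordDomain {x : M} (hx : x ∈ φ.source) (hfx : f x ∈ ψ.source) :
    φ x ∈ coordDomain φ ψ f :=
  ⟨φ.map_source hx, by simpa only [Set.mem_preimage, φ.left_inv hx]⟩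

end

variable {𝕜 : Type*} [NontriviallyNormedField 𝕜]
  [NormedAddCommGroup E] [NormedSpace 𝕜 E] [NormedAddCommGroup E'] [NormedSpace 𝕜 E']
  [ChartedSpace E M] [IsManifold 𝓘(𝕜, E) 1 M] [ChartedSpace E' N] [IsManifold 𝓘(𝕜, E') 1 N]
  {φ : OpenPartialHomeomorph M E} {ψ : OpenPartialHomeomorph N E'} {f : M → N}

lemma differentiableOn_coordDomain (hf : MDifferentiable 𝓘(𝕜, E) 𝓘(𝕜, E') f)
    (hφ : φ ∈ atlas E M) (hψ : ψ ∈ atlas E' N) :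
    DifferentiableOn 𝕜 (ψ ∘ f ∘ φ.symm) (coordDomain φ ψ f) := fun y hy =>
  (mdifferentiableAt_iff_differentiableAt.mp <|
    (mdifferentiableAt_atlas hψ hy.2).comp y
      ((hf _).comp y (mdifferentiableAt_atlas_symm hφ hy.1))).differentiableWithinAt

lemma fderiv_apply_mfderiv (hf : MDifferentiable 𝓘(𝕜, E) 𝓘(𝕜, E') f)
    (hφ : φ ∈ atlas E M) (hψ : ψ ∈ atlas E' N) {x : M} (hx : x ∈ φ.source)
    (hfx : f x ∈ ψ.source) (v : TangentSpace 𝓘(𝕜, E) x) :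
    fderiv 𝕜 (ψ ∘ f ∘ φ.symm) (φ x) (mfderiv 𝓘(𝕜, E) 𝓘(𝕜, E) φ x v)
      = mfderiv 𝓘(𝕜, E') 𝓘(𝕜, E') ψ (f x) (mfderiv 𝓘(𝕜, E) 𝓘(𝕜, E') f x v) := by
  have hF : DifferentiableAt 𝕜 (ψ ∘ f ∘ φ.symm) (φ x) :=
    (differentiableOn_coordDomain hf hφ hψ).differentiableAt
      ((isOpen_coordDomain hf.continuous).mem_nhds (mem_coordDomain hx hfx))
  have heq : (ψ ∘ f ∘ φ.symm) ∘ φ =ᶠ[𝓝 x] ψ ∘ f := by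
    filter_upwards [φ.eventually_left_inverse hx] with z hz
    simp [hz]
  have hleft := mfderiv_comp_apply x hF.mdifferentiableAt
    (mdifferentiableAt_atlas (I := 𝓘(𝕜, E)) hφ hx) v
  have hright := mfderiv_comp_apply x (mdifferentiableAt_atlas (I := 𝓘(𝕜, E')) hψ hfx) (hf x) v
  rw [mfderiv_eq_fderiv, heq.mfderiv_eq] at hleft
  exact hleft.symm.trans hright

end ChartExpression

lemma isLocallyConstant_of_mfderiv_eq_zero {𝕜 E E' M N : Type*} [RCLike 𝕜]
    [NormedAddCommGroup E] [NormedSpace 𝕜 E] [NormedAddCommGroup E'] [NormedSpace 𝕜 E']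
    [TopologicalSpace M] [ChartedSpace E M] [IsManifold 𝓘(𝕜, E) 1 M]
    [TopologicalSpace N] [ChartedSpace E' N] [IsManifold 𝓘(𝕜, E') 1 N]
    {f : M → N} (hf : MDifferentiable 𝓘(𝕜, E) 𝓘(𝕜, E') f)
    (hzero : ∀ x, mfderiv 𝓘(𝕜, E) 𝓘(𝕜, E') f x = 0) : IsLocallyConstant f := by
  let := NormedSpace.restrictScalars ℝ 𝕜 E
  rw [IsLocallyConstant.iff_eventually_eq]
  intro x
  set φ := chartAt E x
  set ψ := chartAt E' (f x)
  have hφ : φ ∈ atlas E M := chart_mem_atlas E x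
  have hψ : ψ ∈ atlas E' N := chart_mem_atlas E' (f x)
  have hx : x ∈ φ.source := mem_chart_source E x
  have hfx : f x ∈ ψ.source := mem_chart_source E' (f x)
  have hfderiv : (coordDomain φ ψ f).EqOn (fderiv 𝕜 (ψ ∘ f ∘ φ.symm)) 0 := by
    rintro y ⟨hy, hfy⟩
    ext v
    obtain ⟨w, rfl⟩ := (mdifferentiable_of_mem_atlas (I := 𝓘(𝕜, E)) hφ).mfderiv_surjective
      (φ.map_target hy) v
    have := fderiv_apply_mfderiv hf hφ hψ (φ.map_target hy) hfy w
    rw [φ.right_inv hy, hzero] at this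
    exact this.trans (map_zero _)
  have hopen := (isOpen_coordDomain hf.continuous).isOpen_inter_preimage_of_fderiv_eq_zero
    (differentiableOn_coordDomain hf hφ hψ) hfderiv {ψ (f x)}
  filter_upwards [φ.open_source.mem_nhds hx, (φ.continuousAt hx).preimage_mem_nhds
    (hopen.mem_nhds ⟨mem_coordDomain hx hfx, by simp [φ.left_inv hx]⟩)] with z hz hzx
  have hfz : f z ∈ ψ.source := by simpa only [Set.mem_preimage, φ.left_inv hz] using hzx.1.2
  exact ψ.injOn hfz hfx (by simpa [φ.left_inv hz] using hzx.2)

section Distortion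

variable {m n : ℕ} {M : Type*} [TopologicalSpace M] [ChartedSpace (CSpace m) M]
  {N : Type*} [TopologicalSpace N] [ChartedSpace (CSpace n) N]

namespace HermitianMetric

/-- The ratio of the squared lengths of `df(v)` and `v`. Its value at `v = 0` is `0`. -/
def distortion (g : HermitianMetric m M) (h : HermitianMetric n N) (f : M → N) (x : M)
    (v : TangentSpace 𝓘(ℂ, CSpace m) x) : ℝ :=
  (h.form (f x) (mfderiv 𝓘(ℂ, CSpace m) 𝓘(ℂ, CSpace n) f x v)
    (mfderiv 𝓘(ℂ, CSpace m) 𝓘(ℂ, CSpace n) f x v)).re / (g.form x v v).re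

/-- The distortion of the map with expression `F` in the charts `φ` and `ψ`. -/
def coordDistortion (g : HermitianMetric m M) (h : HermitianMetric n N)
    (φ : OpenPartialHomeomorph M (CSpace m)) (ψ : OpenPartialHomeomorph N (CSpace n))
    (F : CSpace m → CSpace n) (y v : CSpace m) : ℝ :=
  h.coordNormSq ψ (F y) (fderiv ℂ F y v) / g.coordNormSq φ y v

variable (g : HermitianMetric m M) (h : HermitianMetric n N)
  {φ : OpenPartialHomeomorph M (CSpace m)} {ψ : OpenPartialHomeomorph N (CSpace n)}

lemma coordNormSq_smul (φ : OpenPartialHomeomorph M (CSpace m)) (c : ℝ) (y v : CSpace m) :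
    g.coordNormSq φ y (c • v) = c ^ 2 * g.coordNormSq φ y v := by
  simp only [coordNormSq, sesqForm_eq_sum, PiLp.smul_apply, Complex.real_smul, map_mul,
    Complex.conj_ofReal, ← Complex.re_ofReal_mul, Finset.mul_sum]
  congr! 3
  push_cast
  ring

lemma coordDistortion_zero (F : CSpace m → CSpace n) (y : CSpace m) :
    g.coordDistortion h φ ψ F y 0 = 0 := by
  rw [coordDistortion, coordNormSq_zero, div_zero]

lemma coordDistortion_smul (F : CSpace m → CSpace n) (y v : CSpace m) {c : ℝ} (hc : c ≠ 0) :
    g.coordDistortion h φ ψ F y (c • v) = g.coordDistortion h φ ψ F y v := by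
  rw [coordDistortion, (fderiv ℂ F y).map_smul_of_tower, coordNormSq_smul, coordNormSq_smul,
    mul_div_mul_left _ _ (pow_ne_zero 2 hc), coordDistortion]

lemma continuousOn_coordNormSq {X : Type*} [TopologicalSpace X] {s : Set X} {y v : X → CSpace m}
    (hφ : φ ∈ atlas (CSpace m) M) (hy : ContinuousOn y s) (hys : Set.MapsTo y s φ.target)
    (hv : ContinuousOn v s) : ContinuousOn (fun x => g.coordNormSq φ (y x) (v x)) s := by
  have hcomp (k l : Fin m) : ContinuousOn (fun x => g.comp φ k l (y x)) s :=
    (g.smooth φ hφ k l).continuousOn.comp hy hys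
  simp only [coordNormSq, sesqForm_eq_sum, gram, Matrix.of_apply]
  fun_prop

section Pointwise

variable {f : M → N} {x : M} {v : TangentSpace 𝓘(ℂ, CSpace m) x}

lemma distortion_mul_form (hv : v ≠ 0) : g.distortion h f x v * (g.form x v v).re
    = (h.form (f x) (mfderiv 𝓘(ℂ, CSpace m) 𝓘(ℂ, CSpace n) f x v)
      (mfderiv 𝓘(ℂ, CSpace m) 𝓘(ℂ, CSpace n) f x v)).re :=
  div_mul_cancel₀ _ (g.pos x v hv).ne'

lemma distortion_pos (hdf : mfderiv 𝓘(ℂ, CSpace m) 𝓘(ℂ, CSpace n) f x v ≠ 0) :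
    0 < g.distortion h f x v :=
  div_pos (h.pos _ _ hdf) (g.pos x v (ne_zero_of_map hdf))

lemma mfderiv_ne_zero_of_distortion_ne_zero (hv : g.distortion h f x v ≠ 0) :
    mfderiv 𝓘(ℂ, CSpace m) 𝓘(ℂ, CSpace n) f x v ≠ 0 :=
  fun hzero => hv (by simp [distortion, hzero])

end Pointwise

section Manifold

variable [IsManifold 𝓘(ℂ, CSpace m) 1 M]

lemma coordNormSq_coordComp (hφ : φ ∈ atlas (CSpace m) M) {x : M} (hx : x ∈ φ.source)
    (v : TangentSpace 𝓘(ℂ, CSpace m) x) :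
    g.coordNormSq φ (φ x) (coordComp φ x v) = (g.form x v v).re := by
  have hdiff := mdifferentiable_of_mem_atlas (I := 𝓘(ℂ, CSpace m)) hφ
  obtain ⟨y, hy, rfl⟩ := φ.symm.surjOn hx
  obtain ⟨u, rfl⟩ := hdiff.symm.mfderiv_surjective hy v
  have hu : coordComp φ (φ.symm y) (mfderiv 𝓘(ℂ, CSpace m) 𝓘(ℂ, CSpace m) φ.symm y u) = u :=
    DFunLike.congr_fun (hdiff.comp_symm_deriv hy) u
  rw [hu, φ.right_inv hy]
  exact g.coordNormSq_eq φ y u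

lemma continuousOn_coordDistortion {F : CSpace m → CSpace n} {U : Set (CSpace m)}
    (hφ : φ ∈ atlas (CSpace m) M) (hψ : ψ ∈ atlas (CSpace n) N)
    (hU : IsOpen U) (hUφ : U ⊆ φ.target) (hF : DifferentiableOn ℂ F U)
    (hFU : Set.MapsTo F U ψ.target) :
    ContinuousOn (fun p : CSpace m × CSpace m => g.coordDistortion h φ ψ F p.1 p.2)
      (U ×ˢ {0}ᶜ) := by
  have hfst : Set.MapsTo Prod.fst (U ×ˢ ({0}ᶜ : Set (CSpace m))) U := fun p hp => hp.1
  exact (h.continuousOn_coordNormSq hψ (hF.continuousOn.comp continuousOn_fst hfst)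
    (hFU.comp hfst) (((continuousOn_fderiv_of_differentiableOn hF hU).comp continuousOn_fst
      hfst).clm_apply continuousOn_snd)).div
    (g.continuousOn_coordNormSq hφ continuousOn_fst (fun p hp => hUφ hp.1) continuousOn_snd)
    fun p hp => (g.coordNormSq_pos hφ (hUφ hp.1) hp.2).ne'

lemma coordDistortion_nonneg [IsManifold 𝓘(ℂ, CSpace n) 1 N] (hφ : φ ∈ atlas (CSpace m) M)
    (hψ : ψ ∈ atlas (CSpace n) N) {F : CSpace m → CSpace n} {y : CSpace m} (hy : y ∈ φ.target)
    (hFy : F y ∈ ψ.target) (v : CSpace m) : 0 ≤ g.coordDistortion h φ ψ F y v :=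
  div_nonneg (h.coordNormSq_nonneg hψ hFy _) (g.coordNormSq_nonneg hφ hy v)

variable [IsManifold 𝓘(ℂ, CSpace n) 1 N] {f : M → N}

lemma coordDistortion_coordComp (hf : MDifferentiable 𝓘(ℂ, CSpace m) 𝓘(ℂ, CSpace n) f)
    (hφ : φ ∈ atlas (CSpace m) M) (hψ : ψ ∈ atlas (CSpace n) N) {x : M} (hx : x ∈ φ.source)
    (hfx : f x ∈ ψ.source) (v : TangentSpace 𝓘(ℂ, CSpace m) x) :
    g.coordDistortion h φ ψ (ψ ∘ f ∘ φ.symm) (φ x) (coordComp φ x v) = g.distortion h f x v := by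
  have hderiv : fderiv ℂ (ψ ∘ f ∘ φ.symm) (φ x) (coordComp φ x v)
      = coordComp ψ (f x) (mfderiv 𝓘(ℂ, CSpace m) 𝓘(ℂ, CSpace n) f x v) :=
    fderiv_apply_mfderiv hf hφ hψ hx hfx v
  rw [coordDistortion, hderiv, g.coordNormSq_coordComp hφ hx, distortion, Function.comp_apply,
    Function.comp_apply, φ.left_inv hx, h.coordNormSq_coordComp hψ hfx]

lemma exists_distortion_eq_coordDistortion
    (hf : MDifferentiable 𝓘(ℂ, CSpace m) 𝓘(ℂ, CSpace n) f) (hφ : φ ∈ atlas (CSpace m) M)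
    (hψ : ψ ∈ atlas (CSpace n) N) {y : CSpace m} (hy : y ∈ coordDomain φ ψ f) (v : CSpace m) :
    ∃ x w, g.distortion h f x w = g.coordDistortion h φ ψ (ψ ∘ f ∘ φ.symm) y v := by
  obtain ⟨w, rfl⟩ := (mdifferentiable_of_mem_atlas (I := 𝓘(ℂ, CSpace m)) hφ).mfderiv_surjective
    (φ.map_target hy.1) v
  have heq := g.coordDistortion_coordComp h hf hφ hψ (φ.map_target hy.1) hy.2 w
  rw [φ.right_inv hy.1] at heq
  exact ⟨_, w, heq.symm⟩

lemma exists_forall_distortion_le [CompactSpace M] [Nonempty M] [Nontrivial (CSpace m)]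
    (hf : MDifferentiable 𝓘(ℂ, CSpace m) 𝓘(ℂ, CSpace n) f) :
    ∃ x v, ∀ y w, g.distortion h f y w ≤ g.distortion h f x v := by
  refine exists_forall_le_of_forall_eventually fun x₀ => ?_
  set φ := chartAt (CSpace m) x₀
  set ψ := chartAt (CSpace n) (f x₀)
  have hφ : φ ∈ atlas (CSpace m) M := chart_mem_atlas _ x₀
  have hψ : ψ ∈ atlas (CSpace n) N := chart_mem_atlas _ (f x₀)
  have hx₀ : x₀ ∈ φ.source := mem_chart_source _ x₀
  have hfx₀ : f x₀ ∈ ψ.source := mem_chart_source _ (f x₀)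
  have hU : IsOpen (coordDomain φ ψ f) := isOpen_coordDomain hf.continuous
  have hFU : Set.MapsTo (ψ ∘ f ∘ φ.symm) (coordDomain φ ψ f) ψ.target :=
    fun y hy => ψ.map_source hy.2
  obtain ⟨y, hy, v, hmax⟩ := exists_eventually_le_of_continuousOn_prod
    (hU.mem_nhds (mem_coordDomain hx₀ hfx₀))
    (g.continuousOn_coordDistortion h hφ hψ hU Set.inter_subset_left
      (differentiableOn_coordDomain hf hφ hψ) hFU)
    (fun y c v hc => g.coordDistortion_smul h _ y v hc)
    (fun y hy v => (g.coordDistortion_zero h _ y).trans_le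
      (g.coordDistortion_nonneg h hφ hψ hy.1 (hFU hy) v))
  obtain ⟨x, w, hxw⟩ := g.exists_distortion_eq_coordDistortion h hf hφ hψ hy v
  refine ⟨x, w, ?_⟩
  filter_upwards [φ.open_source.mem_nhds hx₀, hf.continuous.continuousAt.preimage_mem_nhds
    (ψ.open_source.mem_nhds hfx₀), (φ.continuousAt hx₀).eventually hmax] with z hz hfz hle u
  rw [hxw, ← g.coordDistortion_coordComp h hf hφ hψ hz hfz]
  exact hle _

lemma distortion_mul_re_curvatureForm_le (hf : MDifferentiable 𝓘(ℂ, CSpace m) 𝓘(ℂ, CSpace n) f)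
    {x : M} {v : TangentSpace 𝓘(ℂ, CSpace m) x} (hv : v ≠ 0)
    (hmax : ∀ y w, g.distortion h f y w ≤ g.distortion h f x v) :
    g.distortion h f x v * (g.curvatureForm x v).re
      ≤ (h.curvatureForm (f x) (mfderiv 𝓘(ℂ, CSpace m) 𝓘(ℂ, CSpace n) f x v)).re := by
  rw [curvatureForm_eq_coordCurvature, curvatureForm_eq_coordCurvature]
  set φ := chartAt (CSpace m) x
  set ψ := chartAt (CSpace n) (f x)
  have hφ : φ ∈ atlas (CSpace m) M := chart_mem_atlas _ x
  have hψ : ψ ∈ atlas (CSpace n) N := chart_mem_atlas _ (f x)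
  have hx : x ∈ φ.source := mem_chart_source _ x
  have hfx : f x ∈ ψ.source := mem_chart_source _ (f x)
  have hderiv : fderiv ℂ (ψ ∘ f ∘ φ.symm) (φ x) (coordComp φ x v)
      = coordComp ψ (f x) (mfderiv 𝓘(ℂ, CSpace m) 𝓘(ℂ, CSpace n) f x v) :=
    fderiv_apply_mfderiv hf hφ hψ hx hfx v
  have heq : h.coordNormSq ψ ((ψ ∘ f ∘ φ.symm) (φ x))
      (fderiv ℂ (ψ ∘ f ∘ φ.symm) (φ x) (coordComp φ x v))
        = g.distortion h f x v * g.coordNormSq φ (φ x) (coordComp φ x v) := by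
    rw [hderiv, Function.comp_apply, Function.comp_apply, φ.left_inv hx,
      g.coordNormSq_coordComp hφ hx, h.coordNormSq_coordComp hψ hfx, g.distortion_mul_form h hv]
  have hle (z) (hz : z ∈ coordDomain φ ψ f) (w : CSpace m) :
      h.coordNormSq ψ ((ψ ∘ f ∘ φ.symm) z) (fderiv ℂ (ψ ∘ f ∘ φ.symm) z w)
        ≤ g.distortion h f x v * g.coordNormSq φ z w := by
    rcases eq_or_ne w 0 with rfl | hw
    · simp
    obtain ⟨z', w', heq⟩ := g.exists_distortion_eq_coordDistortion h hf hφ hψ hz w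
    rw [← div_le_iff₀ (g.coordNormSq_pos hφ hz.1 hw)]
    exact heq.symm.trans_le (hmax z' w')
  have hcurv := g.mul_re_coordCurvature_le_fderiv h hφ hψ (isOpen_coordDomain hf.continuous)
    Set.inter_subset_left (differentiableOn_coordDomain hf hφ hψ)
    (fun y hy => ψ.map_source hy.2) (mem_coordDomain hx hfx) hle heq
  rwa [hderiv, Function.comp_apply, Function.comp_apply, φ.left_inv hx] at hcurv

lemma holSecCurv_le_distortion_mul (hf : MDifferentiable 𝓘(ℂ, CSpace m) 𝓘(ℂ, CSpace n) f)
    {x : M} {v : TangentSpace 𝓘(ℂ, CSpace m) x}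
    (hdf : mfderiv 𝓘(ℂ, CSpace m) 𝓘(ℂ, CSpace n) f x v ≠ 0)
    (hmax : ∀ y w, g.distortion h f y w ≤ g.distortion h f x v) :
    g.holSecCurv x v ≤ g.distortion h f x v
      * h.holSecCurv (f x) (mfderiv 𝓘(ℂ, CSpace m) 𝓘(ℂ, CSpace n) f x v) := by
  have hv : v ≠ 0 := ne_zero_of_map hdf
  have hC : 0 < g.distortion h f x v := g.distortion_pos h hdf
  have hcurv := g.distortion_mul_re_curvatureForm_le h hf hv hmax
  calc g.holSecCurv x v
      ≤ (h.curvatureForm (f x) (mfderiv 𝓘(ℂ, CSpace m) 𝓘(ℂ, CSpace n) f x v)).re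
        / g.distortion h f x v / (g.form x v v).re ^ 2 := by
        rw [holSecCurv]
        gcongr
        rwa [le_div_iff₀' hC]
    _ = _ := by
        rw [holSecCurv, ← g.distortion_mul_form h hv]
        field_simp

lemma exists_holSecCurv_le_distortion_mul [CompactSpace M]
    (hf : MDifferentiable 𝓘(ℂ, CSpace m) 𝓘(ℂ, CSpace n) f) {x₀ : M}
    (hx₀ : mfderiv 𝓘(ℂ, CSpace m) 𝓘(ℂ, CSpace n) f x₀ ≠ 0) :
    ∃ x v, mfderiv 𝓘(ℂ, CSpace m) 𝓘(ℂ, CSpace n) f x v ≠ 0 ∧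
      g.holSecCurv x v ≤ g.distortion h f x v
        * h.holSecCurv (f x) (mfderiv 𝓘(ℂ, CSpace m) 𝓘(ℂ, CSpace n) f x v) := by
  obtain ⟨v₀, hv₀⟩ : ∃ v₀, mfderiv 𝓘(ℂ, CSpace m) 𝓘(ℂ, CSpace n) f x₀ v₀ ≠ 0 :=
    DFunLike.ne_iff.mp hx₀
  have : Nonempty M := ⟨x₀⟩
  have : Nontrivial (CSpace m) := nontrivial_of_ne v₀ 0 (ne_zero_of_map hv₀)
  obtain ⟨x, v, hmax⟩ := g.exists_forall_distortion_le h hf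
  have hC : 0 < g.distortion h f x v := (g.distortion_pos h hv₀).trans_le (hmax x₀ v₀)
  have hdf := g.mfderiv_ne_zero_of_distortion_ne_zero h hC.ne'
  exact ⟨x, v, hdf, g.holSecCurv_le_distortion_mul h hf hdf hmax⟩

end Manifold

end HermitianMetric

end Distortion

end

theorem corollary1p5_general {m n : ℕ}
    {M : Type*} [TopologicalSpace M] [CompactSpace M] [ConnectedSpace M]
    [ChartedSpace (CSpace m) M] [IsManifold 𝓘(ℂ, CSpace m) 1 M]
    {N : Type*} [TopologicalSpace N]
    [ChartedSpace (CSpace n) N] [IsManifold 𝓘(ℂ, CSpace n) 1 N]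
    (g : HermitianMetric m M) (h : HermitianMetric n N)
    {f : M → N} (hf : MDifferentiable 𝓘(ℂ, CSpace m) 𝓘(ℂ, CSpace n) f)
    (hsign : ∀ x v, mfderiv 𝓘(ℂ, CSpace m) 𝓘(ℂ, CSpace n) f x v ≠ 0 →
      h.holSecCurv (f x) (mfderiv 𝓘(ℂ, CSpace m) 𝓘(ℂ, CSpace n) f x v) ≤ 0 ∧
      0 ≤ g.holSecCurv x v ∧
      h.holSecCurv (f x) (mfderiv 𝓘(ℂ, CSpace m) 𝓘(ℂ, CSpace n) f x v) < g.holSecCurv x v) :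
    ∃ c : N, ∀ x : M, f x = c := by
  have hzero (x : M) : mfderiv 𝓘(ℂ, CSpace m) 𝓘(ℂ, CSpace n) f x = 0 := by
    by_contra hx
    obtain ⟨x, v, hdf, hle⟩ := g.exists_holSecCurv_le_distortion_mul h hf hx
    obtain ⟨hh, hg, hlt⟩ := hsign x v hdf
    have hC : 0 < g.distortion h f x v := g.distortion_pos h hdf
    rcases hh.eq_or_lt with heq | hneg
    · rw [heq] at hlt hle
      exact hlt.not_ge (by simpa using hle)
    · exact (mul_neg_of_pos_of_neg hC hneg).not_ge (hg.trans hle)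
  have hconst := isLocallyConstant_of_mfderiv_eq_zero hf hzero
  exact ⟨f (Classical.arbitrary M), fun x => hconst.apply_eq_of_preconnectedSpace _ _⟩

theorem corollary1p5 {m n : ℕ}
    {M : Type*} [TopologicalSpace M] [T2Space M] [CompactSpace M] [ConnectedSpace M]
    [ChartedSpace (CSpace m) M] [IsManifold 𝓘(ℂ, CSpace m) ω M]
    {N : Type*} [TopologicalSpace N] [T2Space N]
    [ChartedSpace (CSpace n) N] [IsManifold 𝓘(ℂ, CSpace n) ω N]
    (g : HermitianMetric m M) (h : HermitianMetric n N)
    (f : M → N) (hf : MDifferentiable 𝓘(ℂ, CSpace m) 𝓘(ℂ, CSpace n) f) :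
    (g.PosHSC → h.NonposHSC → ∃ c : N, ∀ x : M, f x = c) ∧
    (g.NonnegHSC → h.NegHSC → ∃ c : N, ∀ x : M, f x = c) :=
  ⟨fun hg hh => corollary1p5_general g h hf fun x v hdf => have hv := hg x v (ne_zero_of_map hdf)
      ⟨hh _ _ hdf, hv.le, (hh _ _ hdf).trans_lt hv⟩,
    fun hg hh => corollary1p5_general g h hf fun x v hdf => have hv := hg x v (ne_zero_of_map hdf)
      ⟨(hh _ _ hdf).le, hv, (hh _ _ hdf).trans_le hv⟩⟩
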